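/- Let $X$ be an $\mathbb{R}^N$-valued random vector and $Y$ a real random variable on a probability space $(\Omega,\mathcal F,\mathbb P)$. Put $\nu=\mathrm{Law}(X,Y)$, assumed to be compactly supported, $m=\mathrm{Law}(X)$, and let $\mu$ be the uniform measure on $[0,1]$. Let $F(x,y)=\mathbb P(Y\le y\mid X=x)$ be the conditional cdf and $Q(x,t)=\inf\{\alpha\in\mathbb R: F(x,\alpha)>t\}$, $t\in(0,1)$, the conditional quantile. Assume that for $m$-a.e. $x$ the function $t\mapsto Q(x,t)$ is continuous and strictly increasing on $(0,1)$. Primal problem: maximize $\int uy\,\theta(dx,dy,du)$ over the set of measures $\theta$ on $\mathbb R^N\times\mathbb R\times[0,1]$ whose $(x,y)$-marginal is $\nu$ and whose $(x,u)$-marginal is $m\otimes\mu$. Dual problem: minimize $\int\varphi\,d(m\otimes\mu)+\int\psi\,d\nu$ over pairs $\varphi:\mathbb R^N\times[0,1]\to\mathbb R$ in $L^1(m\otimes\mu)$ and $\psi:\mathbb R^N\times\mathbb R\to\mathbb R$ in $L^1(\nu)$ such that $\varphi(x,u)+\psi(x,y)\ge uy$ for all $x\in\mathbb R^N$, $u\in[0,1]$,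 $y\in\mathbb R$. By a solution of the dual problem we mean a minimizing pair $(\varphi,\psi)$ such that, for $m$-a.e. $x$, $\varphi(x,\cdot)$ and $\psi(x,\cdot)$ are convex conjugates, i.e. $\varphi(x,u)=\sup_{y\in\mathbb R}\{uy-\psi(x,y)\}$ for all $u\in[0,1]$ and $\psi(x,y)=\sup_{u\in[0,1]}\{uy-\varphi(x,u)\}$ for all $y\in\mathbb R$. Theorem. (1) Let $(\varphi,\psi)$ be a solution of the dual problem. Then, for $m$-a.e. $x$, $\varphi(x,\cdot)$ is differentiable on $(0,1)$ with $\partial_u\varphi(x,t)=Q(x,t)$ for every $t\in(0,1)$, and $\psi(x,\cdot)$ is differentiable on $\mathbb R$ with $\partial_y\psi(x,y)=F(x,y)$ for every $y\in\mathbb R$. (2) Let $\theta$ be a solution of the primal problem. Then there is a random variable $U$ on $\Omega$, unique up to almost sure equality, such that $\mathrm{Law}(X,Y,U)=\theta$. It is uniformly distributed on $[0,1]$, independent of $X$, and $U=F(X,Y)$ almost surely. Moreover, for every solution $(\varphi,\psi)$ of the dual problem, almost surely $U\in(0,1)$, $\varphi(X,\cdot)$ is differentiable at $U$ and $Y=\partial_u\varphi(X,U)$;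 and this relation determines $U$: any $V:\Omega\to\mathbb R$ such that almost surely $V\in(0,1)$, $\varphi(X,\cdot)$ is differentiable at $V$ and $Y=\partial_u\varphi(X,V)$ equals $U$ almost surely. -/

import Mathlib

open MeasureTheory ProbabilityTheory Set

namespace CondQuantile

noncomputable section

/-- The uniform measure on `[0,1]`, seen as a measure on `ℝ`. -/
def unif : Measure ℝ := volume.restrict (Icc 0 1)

/-- The conditional cumulative distribution function `F(x,y) = ℙ(Y ≤ y | X = x)`. -/
def condF {Ω E : Type*} [MeasurableSpace Ω] [MeasurableSpace E] (P : Measure Ω)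
    [IsProbabilityMeasure P] (X : Ω → E) (Y : Ω → ℝ) (x : E) (y : ℝ) : ℝ :=
  cdf (condDistrib Y X P x) y

/-- The conditional quantile `Q(x,t) = inf {α : F(x,α) > t}`, meaningful for `t ∈ (0,1)`. -/
def condQ {Ω E : Type*} [MeasurableSpace Ω] [MeasurableSpace E] (P : Measure Ω)
    [IsProbabilityMeasure P] (X : Ω → E) (Y : Ω → ℝ) (x : E) (t : ℝ) : ℝ :=
  sInf {α : ℝ | t < condF P X Y x α}

section Problems

variable {E : Type*} [MeasurableSpace E]

/-- The measures `θ` on triples `(x, y, u)` whose `(x,y)` marginal is `ν` and whose `(x,u)`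
marginal is `m ⊗ unif`, where `m` is the first marginal of `ν`. When `ν` is a probability
measure these are probability measures, concentrated on `u ∈ [0,1]`. -/
def Plans (ν : Measure (E × ℝ)) : Set (Measure (E × ℝ × ℝ)) :=
  {θ | θ.map (fun p => (p.1, p.2.1)) = ν ∧ θ.map (fun p => (p.1, p.2.2)) = ν.fst.prod unif}

/-- `θ` solves the correlation maximization problem: it maximizes `∫ u y dθ` over `Plans ν`. -/
def IsPrimalSolution (ν : Measure (E × ℝ)) (θ : Measure (E × ℝ × ℝ)) : Prop :=
  θ ∈ Plans ν ∧
    ∀ θ' ∈ Plans ν, ∫ p, p.2.2 * p.2.1 ∂θ' ≤ ∫ p, p.2.2 * p.2.1 ∂θ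

/-- Admissible pairs of potentials `φ` on `E × [0,1]` and `ψ` on `E × ℝ`: the values of
`φ x u` for `u ∉ [0,1]` play no role. -/
structure Admissible (ν : Measure (E × ℝ)) (φ ψ : E → ℝ → ℝ) : Prop where
  integrable_left : Integrable (fun p : E × ℝ => φ p.1 p.2) (ν.fst.prod unif)
  integrable_right : Integrable (fun p : E × ℝ => ψ p.1 p.2) ν
  le : ∀ x, ∀ u ∈ Icc (0 : ℝ) 1, ∀ y, u * y ≤ φ x u + ψ x y

/-- The dual cost `J(φ,ψ)`. -/
def dualCost (ν : Measure (E × ℝ)) (φ ψ : E → ℝ → ℝ) : ℝ :=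
  ∫ p, φ p.1 p.2 ∂(ν.fst.prod unif) + ∫ p, ψ p.1 p.2 ∂ν

/-- `(φ,ψ)` attains the infimum of the dual cost over all admissible pairs. -/
def IsDualMinimizer (ν : Measure (E × ℝ)) (φ ψ : E → ℝ → ℝ) : Prop :=
  Admissible ν φ ψ ∧ ∀ φ' ψ', Admissible ν φ' ψ' → dualCost ν φ ψ ≤ dualCost ν φ' ψ'

/-- `f` on `[0,1]` and `g` on `ℝ` are convex conjugates of one another:
`f u = sup_y (u y - g y)` for `u ∈ [0,1]` and `g y = sup_{u ∈ [0,1]} (u y - f u)`. -/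
def AreConjugate (f g : ℝ → ℝ) : Prop :=
  (∀ u ∈ Icc (0 : ℝ) 1, IsLUB (range fun y => u * y - g y) (f u)) ∧
    ∀ y, IsLUB ((fun u => u * y - f u) '' Icc 0 1) (g y)

/-- A solution of the dual problem: a minimizer which is, for almost every `x`, a pair of
conjugate convex functions. -/
def IsDualSolution (ν : Measure (E × ℝ)) (φ ψ : E → ℝ → ℝ) : Prop :=
  IsDualMinimizer ν φ ψ ∧ ∀ᵐ x ∂ν.fst, AreConjugate (φ x) (ψ x)

end Problems

end

end CondQuantile

/-! Fix `x` and let `κ` be the law of `Y` given `X = x`, with cdf `F` and quantile `Q`. Strict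
monotonicity of `Q` excludes atoms, so `F` is continuous and pushes `κ` to the uniform law;
continuity of `Q` excludes flat pieces of `F` at levels in `(0,1)`.

Duality is made explicit by the primitives of `Q` and `F`: their slack in `u * y ≤ φ u + ψ y` is the
`κ`-integral of a nonnegative function, and it vanishes exactly when `u = F y`
(`potentials_eq_iff`). These potentials and the plan carried by the graph of `F` therefore have
equal values, and complementary slackness (`Admissible.ae_eq_of_dualCost_le`) does the rest. Every
optimal plan lives on `u = F(x,y)`, hence equals `cdfPlan`; every dual minimizer satisfies the
equality `φ(x, F y) + ψ(x, y) = F y * y` for `κ`-a.e. `y`.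

For a conjugate pair, this a.e. equality spreads by density and continuity to all levels in `(0,1)`:
`Q` and `F` are continuous subgradient selections of `φ(x,·)` and `ψ(x,·)`, hence their derivatives.
-/

namespace CondQuantile

open Filter Topology

/-- The (right) quantile function of a measure on the line. -/
noncomputable def quantile (κ : Measure ℝ) (t : ℝ) : ℝ := sInf {α : ℝ | t < cdf κ α}

/-! ### Quantile and cdf as inverse functions -/

section Quantile

variable {κ : Measure ℝ} {t y : ℝ}

theorem nonempty_lt_cdf (ht : t < 1) : {α : ℝ | t < cdf κ α}.Nonempty :=
  ((tendsto_cdf_atTop κ).eventually_const_lt ht).exists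

theorem bddBelow_lt_cdf (ht : 0 < t) : BddBelow {α : ℝ | t < cdf κ α} := by
  obtain ⟨a, ha⟩ := ((tendsto_cdf_atBot κ).eventually_lt_const ht).exists
  refine ⟨a, fun b hb => ?_⟩
  by_contra! h
  exact absurd ((monotone_cdf κ) h.le) (not_le.2 (ha.trans hb))

theorem le_quantile (ht : t < 1) (h : cdf κ y ≤ t) : y ≤ quantile κ t := by
  refine le_csInf (nonempty_lt_cdf ht) fun b hb => ?_
  by_contra! hlt
  exact absurd ((monotone_cdf κ) hlt.le) (not_le.2 (h.trans_lt hb))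

theorem quantile_le (ht : 0 < t) (h : t < cdf κ y) : quantile κ t ≤ y :=
  csInf_le (bddBelow_lt_cdf ht) h

theorem le_cdf_quantile (ht : t ∈ Ioo (0 : ℝ) 1) : t ≤ cdf κ (quantile κ t) := by
  have hc : ContinuousWithinAt (cdf κ) (Ioi (quantile κ t)) (quantile κ t) :=
    ((cdf κ).right_continuous _).mono Ioi_subset_Ici_self
  refine ge_of_tendsto hc ?_
  filter_upwards [self_mem_nhdsWithin] with z hz
  by_contra! h
  exact absurd (le_quantile ht.2 h.le) (not_le.2 hz)

/-- A jump of `F` above level `t` at `Q t` would make `Q` constant on an interval of levels. -/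
theorem cdf_quantile (hmono : StrictMonoOn (quantile κ) (Ioo 0 1)) (ht : t ∈ Ioo (0 : ℝ) 1) :
    cdf κ (quantile κ t) = t := by
  refine le_antisymm ?_ (le_cdf_quantile ht)
  by_contra! h
  obtain ⟨s, hs, hs'⟩ := exists_between h
  have h1 : s ∈ Ioo (0 : ℝ) 1 := ⟨ht.1.trans hs, hs'.trans_le (cdf_le_one κ _)⟩
  exact absurd (quantile_le h1.1 hs') (not_le.2 (hmono ht h1 hs))

/-- Levels `s < F y` satisfy `Q s ≤ y`; continuity of `Q` carries this bound to `s = F y`. -/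
theorem quantile_cdf (hcont : ContinuousOn (quantile κ) (Ioo 0 1))
    (hy : cdf κ y ∈ Ioo (0 : ℝ) 1) : quantile κ (cdf κ y) = y := by
  refine le_antisymm ?_ (le_quantile hy.2 le_rfl)
  have hc : ContinuousWithinAt (quantile κ) (Ioo 0 (cdf κ y)) (cdf κ y) :=
    (hcont _ hy).mono fun s hs => ⟨hs.1, hs.2.trans hy.2⟩
  have : (𝓝[Ioo 0 (cdf κ y)] (cdf κ y)).NeBot := by
    rw [← mem_closure_iff_nhdsWithin_neBot, closure_Ioo hy.1.ne]
    exact right_mem_Icc.2 hy.1.le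
  refine le_of_tendsto hc ?_
  filter_upwards [self_mem_nhdsWithin] with s hs using quantile_le hs.1 hs.2

theorem continuous_cdf_of_strictMonoOn_quantile
    (hmono : StrictMonoOn (quantile κ) (Ioo 0 1)) : Continuous (cdf κ) := by
  rw [continuous_iff_continuousAt]
  intro y
  refine tendsto_order.2 ⟨fun b hb => ?_, fun b hb => ?_⟩
  · obtain hb0 | hb0 := lt_or_ge b 0
    · exact Eventually.of_forall fun z => hb0.trans_le (cdf_nonneg κ z)
    · obtain ⟨t, hbt, hty⟩ := exists_between hb
      have ht : t ∈ Ioo (0 : ℝ) 1 := ⟨hb0.trans_lt hbt, hty.trans_le (cdf_le_one κ y)⟩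
      have hlt : quantile κ t < y := by
        by_contra! h
        exact absurd ((monotone_cdf κ) h) (not_le.2 (by rwa [cdf_quantile hmono ht]))
      filter_upwards [Ioi_mem_nhds hlt] with z hz
      refine hbt.trans_le ?_
      rw [← cdf_quantile hmono ht]
      exact monotone_cdf κ (le_of_lt hz)
  · obtain hb1 | hb1 := lt_or_ge 1 b
    · exact Eventually.of_forall fun z => (cdf_le_one κ z).trans_lt hb1
    · obtain ⟨t, hty, htb⟩ := exists_between hb
      have ht : t ∈ Ioo (0 : ℝ) 1 := ⟨(cdf_nonneg κ y).trans_lt hty, htb.trans_le hb1⟩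
      have hlt : y < quantile κ t := by
        by_contra! h
        exact absurd ((monotone_cdf κ) h) (not_le.2 (by rwa [cdf_quantile hmono ht]))
      filter_upwards [Iio_mem_nhds hlt] with z hz
      refine lt_of_le_of_lt ?_ htb
      rw [← cdf_quantile hmono ht]
      exact monotone_cdf κ (le_of_lt hz)

theorem setOf_cdf_le (hmono : StrictMonoOn (quantile κ) (Ioo 0 1)) (ht : t ∈ Ioo (0 : ℝ) 1) :
    {z | cdf κ z ≤ t} = Iic (quantile κ t) := by
  ext z
  refine ⟨fun h => le_quantile ht.2 h, fun h => ?_⟩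
  rw [mem_ofPred_eq, ← cdf_quantile hmono ht]
  exact monotone_cdf κ h

end Quantile

/-! ### The probability integral transform -/

section Uniform

instance : IsProbabilityMeasure unif := ⟨by simp [unif]⟩

theorem unif_Iic {t : ℝ} (ht : t ∈ Icc (0 : ℝ) 1) : unif (Iic t) = ENNReal.ofReal t := by
  have h : Iic t ∩ Icc (0 : ℝ) 1 = Icc 0 t := by
    ext z
    exact ⟨fun hz => ⟨hz.2.1, hz.1⟩, fun hz => ⟨hz.2, hz.1, hz.2.trans ht.2⟩⟩
  rw [unif, Measure.restrict_apply measurableSet_Iic, h, Real.volume_Icc, sub_zero]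

theorem ae_unif_mem_Icc : ∀ᵐ u ∂unif, u ∈ Icc (0 : ℝ) 1 :=
  ae_restrict_mem measurableSet_Icc

theorem ae_unif_mem_Ioo : ∀ᵐ u ∂unif, u ∈ Ioo (0 : ℝ) 1 := by
  rw [unif, ← restrict_Ioo_eq_restrict_Icc]
  exact ae_restrict_mem measurableSet_Ioo

variable {κ : Measure ℝ}

theorem map_cdf_eq_unif [IsProbabilityMeasure κ] (hmono : StrictMonoOn (quantile κ) (Ioo 0 1)) :
    κ.map (cdf κ) = unif := by
  have hF : Measurable (cdf κ) := (monotone_cdf κ).measurable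
  have : IsProbabilityMeasure (κ.map (cdf κ)) := Measure.isProbabilityMeasure_map hF.aemeasurable
  have hmem : ∀ t ∈ Ioo (0 : ℝ) 1, (κ.map (cdf κ)) (Iic t) = ENNReal.ofReal t := by
    intro t ht
    rw [Measure.map_apply hF measurableSet_Iic]
    change κ {z | cdf κ z ≤ t} = _
    rw [setOf_cdf_le hmono ht, ← ofReal_cdf, cdf_quantile hmono ht]
  refine Measure.ext_of_Iic _ _ fun a => ?_
  obtain ha | ha := lt_or_ge 0 a
  · obtain ha1 | ha1 := lt_or_ge a 1
    · rw [hmem a ⟨ha, ha1⟩, unif_Iic ⟨ha.le, ha1.le⟩]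
    · rw [Measure.map_apply hF measurableSet_Iic]
      have h1 : cdf κ ⁻¹' Iic a = univ := eq_univ_of_forall fun z => (cdf_le_one κ z).trans ha1
      rw [h1, measure_univ, eq_comm, ← prob_compl_eq_zero_iff measurableSet_Iic]
      filter_upwards [ae_unif_mem_Icc] with u hu using hu.2.trans ha1
  · have h0 : unif (Iic a) = 0 :=
      measure_mono_null (Iic_subset_Iic.2 ha) (by rw [unif_Iic ⟨le_rfl, zero_le_one⟩]; simp)
    rw [h0]
    refine measure_mono_null (Iic_subset_Iic.2 ha) ?_
    refine le_antisymm (le_of_forall_gt_imp_ge_of_dense fun b hb => ?_) zero_le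
    obtain ⟨q, hq0, hqb⟩ := ENNReal.lt_iff_exists_nnreal_btwn.1 hb
    have hq : (0 : ℝ) < min q (1 / 2) := lt_min (by exact_mod_cast hq0) (by norm_num)
    calc (κ.map (cdf κ)) (Iic 0) ≤ (κ.map (cdf κ)) (Iic (min (q : ℝ) (1 / 2))) :=
          measure_mono (Iic_subset_Iic.2 hq.le)
      _ = ENNReal.ofReal (min (q : ℝ) (1 / 2)) :=
          hmem _ ⟨hq, (min_le_right _ _).trans_lt (by norm_num)⟩
      _ ≤ ENNReal.ofReal q := ENNReal.ofReal_le_ofReal (min_le_left _ _)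
      _ ≤ b := by simpa using hqb.le

theorem real_setOf_cdf_le (hU : κ.map (cdf κ) = unif) {u : ℝ} (hu : u ∈ Icc (0 : ℝ) 1) :
    κ.real {z | cdf κ z ≤ u} = u := by
  have h := unif_Iic hu
  rw [← hU, Measure.map_apply (monotone_cdf κ).measurable measurableSet_Iic] at h
  change (κ {z | cdf κ z ≤ u}).toReal = u
  change κ {z | cdf κ z ≤ u} = _ at h
  rw [h, ENNReal.toReal_ofReal hu.1]

end Uniform

/-! ### Explicit potentials and their duality gap -/

section Potentials

/-- The primitive `∫ z 1_{F z ≤ u} dκ` of the quantile function of `κ`. -/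
noncomputable def quantilePotential (κ : Measure ℝ) (u : ℝ) : ℝ :=
  ∫ z, {z | cdf κ z ≤ u}.indicator id z ∂κ

/-- The primitive `∫ (y - z)⁺ dκ` of the cumulative distribution function of `κ`. -/
noncomputable def cdfPotential (κ : Measure ℝ) (y : ℝ) : ℝ := ∫ z, max (y - z) 0 ∂κ

variable {κ : Measure ℝ}

/-- The nonnegative integrand of the duality gap between the two potentials. -/
noncomputable def gap (κ : Measure ℝ) (u y z : ℝ) : ℝ :=
  max (y - z) 0 - {z | cdf κ z ≤ u}.indicator (fun z => y - z) z

theorem gap_of_le {u y z : ℝ} (h : cdf κ z ≤ u) : gap κ u y z = max (y - z) 0 - (y - z) := by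
  rw [gap, indicator_of_mem (s := {z | cdf κ z ≤ u}) h]

theorem gap_of_lt {u y z : ℝ} (h : u < cdf κ z) : gap κ u y z = max (y - z) 0 := by
  rw [gap, indicator_of_notMem (s := {z | cdf κ z ≤ u}) (not_le.2 h), sub_zero]

theorem gap_nonneg (u y z : ℝ) : 0 ≤ gap κ u y z := by
  obtain h | h := le_or_gt (cdf κ z) u
  · rw [gap_of_le h, sub_nonneg]; exact le_max_left _ _
  · rw [gap_of_lt h]; exact le_max_right _ _

variable [IsProbabilityMeasure κ] {R : ℝ}

theorem measurableSet_cdf_le (κ : Measure ℝ) (u : ℝ) : MeasurableSet {z | cdf κ z ≤ u} :=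
  measurableSet_le (monotone_cdf κ).measurable measurable_const

theorem integrable_id_of_ae_abs_le (hR : ∀ᵐ z ∂κ, |z| ≤ R) : Integrable (id : ℝ → ℝ) κ :=
  .of_bound measurable_id.aestronglyMeasurable R hR

theorem abs_quantilePotential_le (hR : ∀ᵐ z ∂κ, |z| ≤ R) (u : ℝ) :
    |quantilePotential κ u| ≤ R := by
  have := norm_integral_le_of_norm_le_const (μ := κ) (C := R)
    (f := {z | cdf κ z ≤ u}.indicator id) ?_
  · simpa [quantilePotential] using this
  · filter_upwards [hR] with z hz using (norm_indicator_le_norm_self _ _).trans hz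

theorem abs_cdfPotential_le (hR : ∀ᵐ z ∂κ, |z| ≤ R) (y : ℝ) :
    |cdfPotential κ y| ≤ |y| + R := by
  have := norm_integral_le_of_norm_le_const (μ := κ) (C := |y| + R)
    (f := fun z => max (y - z) 0) ?_
  · simpa [cdfPotential] using this
  · filter_upwards [hR] with z hz
    rw [Real.norm_of_nonneg (le_max_right _ _)]
    have h := abs_le.1 hz
    exact max_le (by linarith [le_abs_self y]) (by linarith [abs_nonneg y])

theorem integrable_gap (hR : ∀ᵐ z ∂κ, |z| ≤ R) (u y : ℝ) : Integrable (gap κ u y) κ := by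
  have h : Integrable (fun z => y - z) κ :=
    (integrable_const y).sub (integrable_id_of_ae_abs_le hR)
  exact h.pos_part.sub (h.indicator (measurableSet_cdf_le κ u))

/-- The term `u * y` arises because `{F ≤ u}` has mass exactly `u`. -/
theorem integral_gap (hU : κ.map (cdf κ) = unif) (hR : ∀ᵐ z ∂κ, |z| ≤ R) {u : ℝ}
    (hu : u ∈ Icc (0 : ℝ) 1) (y : ℝ) :
    ∫ z, gap κ u y z ∂κ = quantilePotential κ u + cdfPotential κ y - u * y := by
  have hid := integrable_id_of_ae_abs_le hR
  have h : Integrable (fun z => y - z) κ := (integrable_const y).sub hid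
  have hs : ∫ z in {z | cdf κ z ≤ u}, (y - z) ∂κ = u * y - ∫ z in {z | cdf κ z ≤ u}, z ∂κ := by
    refine (integral_sub (integrable_const y).integrableOn hid.integrableOn).trans ?_
    rw [setIntegral_const, real_setOf_cdf_le hU hu, smul_eq_mul]
    rfl
  have hm := measurableSet_cdf_le κ u
  simp only [gap]
  rw [integral_sub h.pos_part (h.indicator hm), integral_indicator hm,
    hs, quantilePotential, cdfPotential, integral_indicator hm]
  simp only [id]
  ring

theorem le_potentials (hU : κ.map (cdf κ) = unif) (hR : ∀ᵐ z ∂κ, |z| ≤ R) {u : ℝ}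
    (hu : u ∈ Icc (0 : ℝ) 1) (y : ℝ) : u * y ≤ quantilePotential κ u + cdfPotential κ y := by
  have := integral_gap hU hR hu y
  have h0 : 0 ≤ ∫ z, gap κ u y z ∂κ := integral_nonneg (gap_nonneg u y)
  linarith

/-- The gap vanishes a.e. iff `{F ≤ u}` and `(-∞, y]` agree up to a null set; their masses are `u`
and `F y`. -/
theorem potentials_eq_iff (hU : κ.map (cdf κ) = unif) (hR : ∀ᵐ z ∂κ, |z| ≤ R) {u : ℝ}
    (hu : u ∈ Icc (0 : ℝ) 1) (y : ℝ) :
    quantilePotential κ u + cdfPotential κ y = u * y ↔ u = cdf κ y := by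
  have h1 : quantilePotential κ u + cdfPotential κ y = u * y ↔ gap κ u y =ᵐ[κ] 0 := by
    rw [← integral_eq_zero_iff_of_nonneg (gap_nonneg u y) (integrable_gap hR u y),
      integral_gap hU hR hu y, sub_eq_zero]
  rw [h1]
  constructor
  · intro h
    apply le_antisymm
    · rw [← real_setOf_cdf_le hU hu, cdf_eq_real]
      refine ENNReal.toReal_mono (measure_ne_top _ _) (measure_mono_ae ?_)
      filter_upwards [h] with z hz hzu
      by_contra hzy
      have hzy : y < z := not_le.1 hzy
      rw [gap_of_le hzu, max_eq_right (by linarith)] at hz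
      simp only [Pi.zero_apply] at hz
      linarith
    · rw [← real_setOf_cdf_le hU ⟨cdf_nonneg κ y, cdf_le_one κ y⟩]
      conv_rhs => rw [← real_setOf_cdf_le hU hu]
      have hlt : κ.real {z | cdf κ z ≤ cdf κ y} = κ.real (Iic y) := by
        rw [real_setOf_cdf_le hU ⟨cdf_nonneg κ y, cdf_le_one κ y⟩, cdf_eq_real]
      rw [hlt]
      refine ENNReal.toReal_mono (measure_ne_top _ _) (measure_mono_ae ?_)
      -- The gap is zero at `z = y` whatever `u` is, so this point has to be discarded as a null
      -- set.
      have hy : κ {y} = 0 := by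
        refine measure_mono_null (t := cdf κ ⁻¹' {cdf κ y}) (by rintro _ rfl; rfl) ?_
        rw [← Measure.map_apply (monotone_cdf κ).measurable (measurableSet_singleton _), hU, unif]
        exact measure_singleton _
      filter_upwards [h, measure_eq_zero_iff_ae_notMem.1 hy] with z hz hne hzy
      by_contra hzu
      have hzy : z < y := lt_of_le_of_ne hzy hne
      rw [gap_of_lt (not_le.1 hzu), max_eq_left (by linarith)] at hz
      simp only [Pi.zero_apply] at hz
      linarith
  · rintro rfl
    have hsub : Iic y ⊆ {z | cdf κ z ≤ cdf κ y} := fun z hz => monotone_cdf κ hz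
    have heq : Iic y =ᵐ[κ] {z | cdf κ z ≤ cdf κ y} := by
      refine ae_eq_of_subset_of_measure_ge hsub ?_ measurableSet_Iic.nullMeasurableSet
        (measure_ne_top _ _)
      rw [← ENNReal.toReal_le_toReal (measure_ne_top _ _) (measure_ne_top _ _)]
      change κ.real _ ≤ κ.real _
      rw [real_setOf_cdf_le hU hu, cdf_eq_real]
    filter_upwards [heq.mem_iff] with z hz
    by_cases hzy : z ≤ y
    · rw [gap_of_le (hsub hzy), max_eq_left (by linarith)]; simp
    · rw [gap_of_lt (not_le.1 fun h => hzy (hz.2 h)), max_eq_right (by linarith)]; simp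

end Potentials

/-! ### Derivatives of conjugate pairs -/

section Conjugate

/-- The subgradient inequalities at `x` and at `z` trap the first-order remainder between `0` and
`(g z - g x) * (z - x)`. -/
theorem hasDerivAt_of_subgradient {f g : ℝ → ℝ} {s : Set ℝ} {x : ℝ} (hs : s ∈ 𝓝 x)
    (hg : ContinuousAt g x) (h : ∀ a ∈ s, ∀ b ∈ s, f a + g a * (b - a) ≤ f b) :
    HasDerivAt f (g x) x := by
  have hx := mem_of_mem_nhds hs
  rw [hasDerivAt_iff_isLittleO, Asymptotics.isLittleO_iff]
  intro c hc
  filter_upwards [hs, Metric.continuousAt_iff'.1 hg c hc] with z hz hgz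
  have h1 := h x hx z hz
  have h2 := h z hz x hx
  rw [Real.dist_eq] at hgz
  rw [smul_eq_mul, Real.norm_of_nonneg (by linarith), Real.norm_eq_abs]
  calc f z - f x - (z - x) * g x ≤ (g z - g x) * (z - x) := by linarith
    _ ≤ |g z - g x| * |z - x| := by rw [← abs_mul]; exact le_abs_self _
    _ ≤ c * |z - x| := by gcongr

variable {f g : ℝ → ℝ}

theorem AreConjugate.le (h : AreConjugate f g) {u : ℝ} (hu : u ∈ Icc (0 : ℝ) 1) (y : ℝ) :
    u * y - g y ≤ f u :=
  (h.1 u hu).1 ⟨y, rfl⟩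

/-- A supremum of affine functions with slopes in `[0,1]` is nondecreasing and 1-Lipschitz. -/
theorem AreConjugate.right_le_add (h : AreConjugate f g) (y z : ℝ) :
    g z ≤ g y + max (z - y) 0 := by
  refine (h.2 z).2 ?_
  rintro _ ⟨u, hu, rfl⟩
  have h1 := h.le hu y
  have h2 : u * (z - y) ≤ max (z - y) 0 :=
    (mul_le_mul_of_nonneg_left (le_max_left _ _) hu.1).trans
      (mul_le_of_le_one_left (le_max_right _ _) hu.2)
  dsimp only
  linarith

variable {κ : Measure ℝ} [IsProbabilityMeasure κ]

/-- At a level `F z` where the a.e. equality holds, `z = Q (F z)` is a maximizer by conjugacy. Such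
levels accumulate at every `t` from the right, and both sides are continuous in the level. -/
theorem AreConjugate.subgradient_quantile (h : AreConjugate f g)
    (hcont : ContinuousOn (quantile κ) (Ioo 0 1)) (hmono : StrictMonoOn (quantile κ) (Ioo 0 1))
    (hfg : ∀ᵐ y ∂κ, f (cdf κ y) + g y = cdf κ y * y) {t : ℝ} (ht : t ∈ Ioo (0 : ℝ) 1) (y : ℝ) :
    t * y - g y ≤ t * quantile κ t - g (quantile κ t) := by
  have hg : Continuous g := by
    refine LipschitzWith.continuous (K := 1) (LipschitzWith.of_dist_le_mul fun a b => ?_)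
    have h1 := h.right_le_add a b
    have h2 := h.right_le_add b a
    rw [Real.dist_eq, Real.dist_eq, NNReal.coe_one, one_mul, abs_le]
    have h3 : max (b - a) 0 ≤ |a - b| := max_le (by rw [abs_sub_comm]; exact le_abs_self _)
      (abs_nonneg _)
    have h4 : max (a - b) 0 ≤ |a - b| := max_le (le_abs_self _) (abs_nonneg _)
    constructor <;> linarith
  have hcont' : ContinuousWithinAt
      (fun s => s * quantile κ s - g (quantile κ s) - (s * y - g y)) (Ioo t 1) t := by
    have hq : ContinuousWithinAt (quantile κ) (Ioo t 1) t :=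
      (hcont t ht).mono fun s hs => ⟨ht.1.trans hs.1, hs.2⟩
    have hid : ContinuousWithinAt (fun s : ℝ => s) (Ioo t 1) t := continuousWithinAt_id
    exact ((hid.mul hq).sub (hg.continuousAt.comp_continuousWithinAt hq)).sub
      ((hid.mul continuousWithinAt_const).sub continuousWithinAt_const)
  rw [← sub_nonneg]
  have hfreq : ∃ᶠ s in 𝓝[Ioo t 1] t,
      s * quantile κ s - g (quantile κ s) - (s * y - g y) ∈ Ici (0 : ℝ) := by
    rw [nhdsWithin_Ioo_eq_nhdsGT ht.2, (nhdsGT_basis t).frequently_iff]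
    intro b hb
    obtain ⟨c, hc, hcb⟩ := exists_between (lt_min hb ht.2)
    obtain ⟨d, hd, hdc⟩ := exists_between hc
    have hcI : c ∈ Ioo (0 : ℝ) 1 := ⟨ht.1.trans hc, hcb.trans_le (min_le_right _ _)⟩
    have hdI : d ∈ Ioo (0 : ℝ) 1 := ⟨ht.1.trans hd, hdc.trans hcI.2⟩
    -- This interval has mass `c - d > 0`, so it contains a point `z` of the full-measure set; then
    -- `d ≤ F z ≤ c` places the level strictly between `t` and `b`.
    have hpos : κ (Ioc (quantile κ d) (quantile κ c)) ≠ 0 := by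
      have hIoc := (cdf κ).measure_Ioc (quantile κ d) (quantile κ c)
      rw [measure_cdf κ] at hIoc
      rw [hIoc, cdf_quantile hmono hcI, cdf_quantile hmono hdI]
      simpa using hdc
    obtain ⟨z, hz, hzf⟩ := (frequently_ae_mem_iff.2 hpos).and_eventually hfg |>.exists
    have h1 : d ≤ cdf κ z := by
      rw [← cdf_quantile hmono hdI]; exact monotone_cdf κ hz.1.le
    have h2 : cdf κ z ≤ c := by
      rw [← cdf_quantile hmono hcI]; exact monotone_cdf κ hz.2
    have hzI : cdf κ z ∈ Ioo (0 : ℝ) 1 := ⟨hdI.1.trans_le h1, h2.trans_lt hcI.2⟩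
    refine ⟨cdf κ z, ⟨hd.trans_le h1, h2.trans_lt (hcb.trans_le (min_le_left _ _))⟩, ?_⟩
    rw [quantile_cdf hcont hzI, mem_Ici]
    have := h.le ⟨hzI.1.le, hzI.2.le⟩ y
    linarith
  exact isClosed_Ici.mem_of_frequently_of_tendsto hfreq hcont'

theorem AreConjugate.hasDerivAt_left (h : AreConjugate f g)
    (hcont : ContinuousOn (quantile κ) (Ioo 0 1)) (hmono : StrictMonoOn (quantile κ) (Ioo 0 1))
    (hfg : ∀ᵐ y ∂κ, f (cdf κ y) + g y = cdf κ y * y) {t : ℝ} (ht : t ∈ Ioo (0 : ℝ) 1) :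
    HasDerivAt f (quantile κ t) t := by
  refine hasDerivAt_of_subgradient (isOpen_Ioo.mem_nhds ht)
    (hcont.continuousAt (isOpen_Ioo.mem_nhds ht)) fun a ha b hb => ?_
  have h1 : f a ≤ a * quantile κ a - g (quantile κ a) := by
    refine (h.1 a ⟨ha.1.le, ha.2.le⟩).2 ?_
    rintro _ ⟨y, rfl⟩
    exact h.subgradient_quantile hcont hmono hfg ha y
  have h2 := h.le ⟨hb.1.le, hb.2.le⟩ (quantile κ a)
  linarith

/-- For `0 < F y < 1` this is the previous inequality at level `F y`. At the extreme values `0` and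
`1`, where `Q` is not controlled, it follows by a limit of interior levels. -/
theorem AreConjugate.subgradient_cdf (h : AreConjugate f g)
    (hcont : ContinuousOn (quantile κ) (Ioo 0 1)) (hmono : StrictMonoOn (quantile κ) (Ioo 0 1))
    (hfg : ∀ᵐ y ∂κ, f (cdf κ y) + g y = cdf κ y * y) (y z : ℝ) :
    g y + cdf κ y * (z - y) ≤ g z := by
  have key : ∀ t ∈ Ioo (0 : ℝ) 1, _ := fun t ht =>
    h.subgradient_quantile hcont hmono hfg ht z
  have hle_zero : ∀ c d : ℝ, (∀ t ∈ Ioo (0 : ℝ) (1 / 2), t * c ≤ d) → 0 ≤ d := by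
    intro c d hcd
    have ht : Tendsto (fun t : ℝ => t * c) (𝓝[>] 0) (𝓝 0) := by
      have : Tendsto (fun t : ℝ => t * c) (𝓝 0) (𝓝 (0 * c)) := tendsto_id.mul_const c
      rw [zero_mul] at this
      exact this.mono_left nhdsWithin_le_nhds
    refine le_of_tendsto ht ?_
    filter_upwards [Ioo_mem_nhdsGT (show (0 : ℝ) < 1 / 2 by norm_num)] with t ht' using hcd t ht'
  have hhalf : (1 / 2 : ℝ) ∈ Ioo (0 : ℝ) 1 := by norm_num
  obtain h0 | h0 := (cdf_nonneg κ y).eq_or_lt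
  -- Here `y ≤ Q t` gives `g y ≤ g (Q t)`, and `t * Q t ≤ t * Q (1/2)` removes the moving point
  -- before `t → 0`.
  · have := hle_zero (z - quantile κ (1 / 2)) (g z - g y) fun t ht => by
      have htI : t ∈ Ioo (0 : ℝ) 1 := ⟨ht.1, ht.2.trans (by norm_num)⟩
      have h1 := key t htI
      have h2 : t * quantile κ t ≤ t * quantile κ (1 / 2) :=
        mul_le_mul_of_nonneg_left (hmono.monotoneOn htI hhalf ht.2.le) ht.1.le
      have h3 := h.right_le_add (quantile κ t) y
      rw [max_eq_right (sub_nonpos.2 (le_quantile htI.2 (h0 ▸ htI.1.le)))] at h3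
      linarith
    rw [← h0]; linarith
  obtain h1 | h1 := (cdf_le_one κ y).eq_or_lt
  -- Mirror case with `t = 1 - s`: now `Q t ≤ y`, and the slope bound `1` on `g` replaces
  -- monotonicity.
  · have := hle_zero (quantile κ (1 / 2) - z) (g z - g y - (z - y)) fun s hs => by
      have htI : 1 - s ∈ Ioo (0 : ℝ) 1 := ⟨by linarith [hs.2], by linarith [hs.1]⟩
      have h1' := key (1 - s) htI
      have h2 : s * quantile κ (1 / 2) ≤ s * quantile κ (1 - s) :=
        mul_le_mul_of_nonneg_left (hmono.monotoneOn hhalf htI (by linarith [hs.2])) hs.1.le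
      have h3 := h.right_le_add (quantile κ (1 - s)) y
      rw [max_eq_left (sub_nonneg.2 (quantile_le htI.1 (h1 ▸ htI.2)))] at h3
      linarith
    rw [h1]; linarith
  · have h2 := key _ ⟨h0, h1⟩
    rw [quantile_cdf hcont ⟨h0, h1⟩] at h2
    linarith

theorem AreConjugate.hasDerivAt_right (h : AreConjugate f g)
    (hcont : ContinuousOn (quantile κ) (Ioo 0 1)) (hmono : StrictMonoOn (quantile κ) (Ioo 0 1))
    (hfg : ∀ᵐ y ∂κ, f (cdf κ y) + g y = cdf κ y * y) (y : ℝ) :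
    HasDerivAt g (cdf κ y) y :=
  hasDerivAt_of_subgradient univ_mem
    (continuous_cdf_of_strictMonoOn_quantile hmono).continuousAt
    fun a _ b _ => h.subgradient_cdf hcont hmono hfg a b

end Conjugate

/-! ### Weak duality and complementary slackness -/

section Duality

variable {E : Type*} [MeasurableSpace E] {ν : Measure (E × ℝ)}
  {θ : Measure (E × ℝ × ℝ)} {φ ψ : E → ℝ → ℝ} {R : ℝ}

theorem measurable_fst_snd : Measurable fun p : E × ℝ × ℝ => (p.1, p.2.1) := by fun_prop

theorem measurable_fst_third : Measurable fun p : E × ℝ × ℝ => (p.1, p.2.2) := by fun_prop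

theorem ae_mem_Icc_of_mem_Plans (hθ : θ ∈ Plans ν) : ∀ᵐ p ∂θ, p.2.2 ∈ Icc (0 : ℝ) 1 := by
  have h : ∀ᵐ p ∂ν.fst.prod unif, p.2 ∈ Icc (0 : ℝ) 1 :=
    Measure.quasiMeasurePreserving_snd.ae ae_unif_mem_Icc
  rw [← hθ.2] at h
  exact ae_of_ae_map measurable_fst_third.aemeasurable h

theorem Admissible.integrable_of_mem_Plans (h : Admissible ν φ ψ) (hθ : θ ∈ Plans ν) :
    Integrable (fun p => φ p.1 p.2.2 + ψ p.1 p.2.1) θ := by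
  have h1 := h.integrable_left
  have h2 := h.integrable_right
  rw [← hθ.2] at h1
  rw [← hθ.1] at h2
  exact (h1.comp_measurable measurable_fst_third).add (h2.comp_measurable measurable_fst_snd)

theorem Admissible.integral_eq_dualCost (h : Admissible ν φ ψ) (hθ : θ ∈ Plans ν) :
    ∫ p, (φ p.1 p.2.2 + ψ p.1 p.2.1) ∂θ = dualCost ν φ ψ := by
  have h1 := h.integrable_left
  have h2 := h.integrable_right
  rw [← hθ.2] at h1
  rw [← hθ.1] at h2
  refine (integral_add (h1.comp_measurable measurable_fst_third)
    (h2.comp_measurable measurable_fst_snd)).trans ?_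
  rw [dualCost, ← hθ.2, integral_map measurable_fst_third.aemeasurable h1.aestronglyMeasurable]
  congr 1
  conv_rhs => rw [← hθ.1]
  exact (integral_map measurable_fst_snd.aemeasurable h2.aestronglyMeasurable).symm

variable [IsProbabilityMeasure ν]

theorem isProbabilityMeasure_of_mem_Plans (hθ : θ ∈ Plans ν) : IsProbabilityMeasure θ := by
  have h : IsProbabilityMeasure (θ.map fun p => (p.1, p.2.1)) := by rw [hθ.1]; infer_instance
  exact (Measure.isProbabilityMeasure_map_iff measurable_fst_snd.aemeasurable).1 h

theorem integrable_mul_of_mem_Plans (hν : ∀ᵐ p ∂ν, |p.2| ≤ R) (hθ : θ ∈ Plans ν) :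
    Integrable (fun p => p.2.2 * p.2.1) θ := by
  have := isProbabilityMeasure_of_mem_Plans hθ
  refine .of_bound (by fun_prop) R ?_
  rw [← hθ.1] at hν
  filter_upwards [ae_of_ae_map measurable_fst_snd.aemeasurable hν,
    ae_mem_Icc_of_mem_Plans hθ] with p hp hu
  rw [norm_mul, Real.norm_of_nonneg hu.1]
  exact (mul_le_of_le_one_left (norm_nonneg _) hu.2).trans hp

/-- The slack is nonnegative `θ`-a.e. and its integral is at most zero. -/
theorem Admissible.ae_eq_of_dualCost_le (h : Admissible ν φ ψ) (hν : ∀ᵐ p ∂ν, |p.2| ≤ R)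
    (hθ : θ ∈ Plans ν) (hle : dualCost ν φ ψ ≤ ∫ p, p.2.2 * p.2.1 ∂θ) :
    ∀ᵐ p ∂θ, φ p.1 p.2.2 + ψ p.1 p.2.1 = p.2.2 * p.2.1 := by
  have h1 := integrable_mul_of_mem_Plans hν hθ
  have h2 := h.integrable_of_mem_Plans hθ
  have hle' : (fun p => p.2.2 * p.2.1) ≤ᵐ[θ] fun p => φ p.1 p.2.2 + ψ p.1 p.2.1 := by
    filter_upwards [ae_mem_Icc_of_mem_Plans hθ] with p hp using h.le _ _ hp _
  have heq := (integral_eq_iff_of_ae_le h1 h2 hle').1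
    (le_antisymm (integral_mono_ae h1 h2 hle') (by rwa [h.integral_eq_dualCost hθ]))
  filter_upwards [heq] with p hp using hp.symm

end Duality

/-! ### Gluing over the conditioning variable -/

section Kernel

variable {E : Type*} [MeasurableSpace E] {ν : Measure (E × ℝ)} [IsProbabilityMeasure ν]
  (κ : Kernel E ℝ) [IsMarkovKernel κ] {φ ψ : E → ℝ → ℝ} {R : ℝ}

theorem measurable_cdf_kernel : Measurable fun p : E × ℝ => cdf (κ p.1) p.2 := by
  have hs : MeasurableSet {q : (E × ℝ) × ℝ | q.2 ≤ q.1.2} :=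
    measurableSet_le (by fun_prop) (by fun_prop)
  have h := Kernel.measurable_kernel_prodMk_left (κ := Kernel.prodMkRight ℝ κ) hs
  simp only [cdf_eq_real]
  exact h.ennreal_toReal

theorem measurable_cdfPotential_kernel : Measurable fun p : E × ℝ => cdfPotential (κ p.1) p.2 := by
  have h : StronglyMeasurable fun q : (E × ℝ) × ℝ => max (q.1.2 - q.2) 0 :=
    Measurable.stronglyMeasurable (by fun_prop)
  exact (StronglyMeasurable.integral_kernel_prod_right' (κ := Kernel.prodMkRight ℝ κ) h).measurable

theorem measurable_quantilePotential_kernel :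
    Measurable fun p : E × ℝ => quantilePotential (κ p.1) p.2 := by
  have hs : MeasurableSet {q : (E × ℝ) × ℝ | cdf (κ q.1.1) q.2 ≤ q.1.2} :=
    measurableSet_le ((measurable_cdf_kernel κ).comp (by fun_prop : Measurable
      fun q : (E × ℝ) × ℝ => (q.1.1, q.2))) (by fun_prop)
  have h : StronglyMeasurable
      ({q : (E × ℝ) × ℝ | cdf (κ q.1.1) q.2 ≤ q.1.2}.indicator fun q => q.2) :=
    (measurable_snd.indicator hs).stronglyMeasurable
  exact (StronglyMeasurable.integral_kernel_prod_right' (κ := Kernel.prodMkRight ℝ κ) h).measurable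

/-- The plan carried by the graph of the conditional distribution function. -/
noncomputable def cdfPlan (ν : Measure (E × ℝ)) : Measure (E × ℝ × ℝ) :=
  ν.map fun p => (p.1, p.2, cdf (κ p.1) p.2)

theorem measurable_graph_cdf :
    Measurable fun p : E × ℝ => (p.1, p.2, cdf (κ p.1) p.2) :=
  measurable_fst.prodMk (measurable_snd.prodMk (measurable_cdf_kernel κ))

variable {κ}

theorem cdfPlan_mem_Plans (hκ : ν.fst ⊗ₘ κ = ν)
    (hU : ∀ᵐ x ∂ν.fst, (κ x).map (cdf (κ x)) = unif) : cdfPlan κ ν ∈ Plans ν := by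
  have hg := measurable_graph_cdf κ
  refine ⟨?_, ?_⟩
  · rw [cdfPlan, Measure.map_map measurable_fst_snd hg]
    exact Measure.map_id
  · rw [cdfPlan, Measure.map_map measurable_fst_third hg]
    refine (Measure.prod_eq fun s t hs ht => ?_).symm
    rw [Measure.map_apply (measurable_fst_third.comp hg) (hs.prod ht)]
    conv_lhs => rw [← hκ]
    rw [Measure.compProd_apply (measurable_fst_third.comp hg (hs.prod ht)),
      mul_comm, ← setLIntegral_const, ← lintegral_indicator hs]
    refine lintegral_congr_ae ?_
    filter_upwards [hU] with x hx
    by_cases hxs : x ∈ s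
    · rw [indicator_of_mem hxs, ← hx, Measure.map_apply (monotone_cdf _).measurable ht]
      congr 1
      ext y
      exact ⟨fun h => h.2, fun h => ⟨hxs, h⟩⟩
    · rw [indicator_of_notMem hxs]
      refine measure_mono_null (t := ∅) (fun y hy => hxs hy.1) measure_empty

theorem exists_admissible_eq_iff (hκ : ν.fst ⊗ₘ κ = ν) (hν : ∀ᵐ p ∂ν, |p.2| ≤ R)
    (hU : ∀ᵐ x ∂ν.fst, (κ x).map (cdf (κ x)) = unif) :
    ∃ φ ψ : E → ℝ → ℝ, Admissible ν φ ψ ∧ ∀ᵐ x ∂ν.fst, ∀ u ∈ Icc (0 : ℝ) 1, ∀ y,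
      φ x u + ψ x y = u * y ↔ u = cdf (κ x) y := by
  classical
  have hR : ∀ᵐ x ∂ν.fst, ∀ᵐ y ∂κ x, |y| ≤ R := by
    rw [← hκ] at hν
    exact Measure.ae_ae_of_ae_compProd hν
  obtain ⟨s, hsub, hs, hs0⟩ := exists_measurable_superset_of_null (hU.and hR)
  have hgood : ∀ x ∉ s, (κ x).map (cdf (κ x)) = unif ∧ ∀ᵐ y ∂κ x, |y| ≤ R := by
    intro x hx
    by_contra h
    exact hx (hsub h)
  have hae : ∀ᵐ x ∂ν.fst, x ∉ s := measure_eq_zero_iff_ae_notMem.1 hs0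
  have hms : MeasurableSet {p : E × ℝ | p.1 ∈ s} := measurable_fst hs
  -- Admissibility is required for every `x`, so on the exceptional null set the pair is replaced by
  -- `0` and `|y|`, which works since `u * y ≤ |y|` on `[0,1]`.
  let φ : E → ℝ → ℝ := fun x u => if x ∈ s then 0 else quantilePotential (κ x) u
  let ψ : E → ℝ → ℝ := fun x y => if x ∈ s then |y| else cdfPotential (κ x) y
  refine ⟨φ, ψ, ⟨?_, ?_, ?_⟩, ?_⟩
  · have hm : Measurable fun p : E × ℝ => φ p.1 p.2 :=
      Measurable.ite hms measurable_const (measurable_quantilePotential_kernel κ)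
    refine .of_bound hm.aestronglyMeasurable R ?_
    filter_upwards [Measure.quasiMeasurePreserving_fst.ae hae] with p hp
    simp only [φ, if_neg hp]
    exact abs_quantilePotential_le (hgood _ hp).2 _
  · have hm : Measurable fun p : E × ℝ => ψ p.1 p.2 :=
      Measurable.ite hms (by fun_prop) (measurable_cdfPotential_kernel κ)
    refine .of_bound hm.aestronglyMeasurable (R + R) ?_
    filter_upwards [ae_of_ae_map measurable_fst.aemeasurable hae, hν] with p hp hpR
    simp only [ψ, if_neg hp]
    exact (abs_cdfPotential_le (hgood _ hp).2 _).trans (by linarith)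
  · intro x u hu y
    by_cases hx : x ∈ s
    · simp only [φ, ψ, if_pos hx, zero_add]
      exact (mul_le_mul_of_nonneg_left (le_abs_self y) hu.1).trans
        (mul_le_of_le_one_left (abs_nonneg y) hu.2)
    · simp only [φ, ψ, if_neg hx]
      exact le_potentials (hgood x hx).1 (hgood x hx).2 hu y
  · filter_upwards [hae] with x hx u hu y
    simp only [φ, ψ, if_neg hx]
    exact potentials_eq_iff (hgood x hx).1 (hgood x hx).2 hu y

theorem dualCost_eq_integral_cdfPlan (hκ : ν.fst ⊗ₘ κ = ν)
    (hU : ∀ᵐ x ∂ν.fst, (κ x).map (cdf (κ x)) = unif) (h : Admissible ν φ ψ)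
    (heq : ∀ᵐ x ∂ν.fst, ∀ u ∈ Icc (0 : ℝ) 1, ∀ y, φ x u + ψ x y = u * y ↔ u = cdf (κ x) y) :
    dualCost ν φ ψ = ∫ p, p.2.2 * p.2.1 ∂cdfPlan κ ν := by
  rw [← h.integral_eq_dualCost (cdfPlan_mem_Plans hκ hU)]
  have h1 := h.integrable_of_mem_Plans (cdfPlan_mem_Plans hκ hU)
  rw [cdfPlan] at h1 ⊢
  have hg := (measurable_graph_cdf κ).aemeasurable (μ := ν)
  rw [integral_map hg h1.aestronglyMeasurable, integral_map hg (by fun_prop)]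
  refine integral_congr_ae ?_
  filter_upwards [ae_of_ae_map measurable_fst.aemeasurable heq] with p hp
  exact (hp _ ⟨cdf_nonneg _ _, cdf_le_one _ _⟩ _).2 rfl

/-- The explicit pair costs exactly the value of `cdfPlan`, so a minimizer costs no more and is
tight on that plan. -/
theorem IsDualMinimizer.ae_eq (hκ : ν.fst ⊗ₘ κ = ν) (hν : ∀ᵐ p ∂ν, |p.2| ≤ R)
    (hU : ∀ᵐ x ∂ν.fst, (κ x).map (cdf (κ x)) = unif) (h : IsDualMinimizer ν φ ψ) :
    ∀ᵐ x ∂ν.fst, ∀ᵐ y ∂κ x, φ x (cdf (κ x) y) + ψ x y = cdf (κ x) y * y := by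
  obtain ⟨φ', ψ', hadm, heq⟩ := exists_admissible_eq_iff hκ hν hU
  have hle := (h.2 φ' ψ' hadm).trans (dualCost_eq_integral_cdfPlan hκ hU hadm heq).le
  have hae := h.1.ae_eq_of_dualCost_le hν (cdfPlan_mem_Plans hκ hU) hle
  have hae' := ae_of_ae_map (measurable_graph_cdf κ).aemeasurable hae
  rw [← hκ] at hae'
  exact Measure.ae_ae_of_ae_compProd hae'

theorem IsPrimalSolution.ae_eq_cdf (hκ : ν.fst ⊗ₘ κ = ν) (hν : ∀ᵐ p ∂ν, |p.2| ≤ R)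
    (hU : ∀ᵐ x ∂ν.fst, (κ x).map (cdf (κ x)) = unif) {θ : Measure (E × ℝ × ℝ)}
    (h : IsPrimalSolution ν θ) : ∀ᵐ p ∂θ, p.2.2 = cdf (κ p.1) p.2.1 := by
  obtain ⟨φ, ψ, hadm, heq⟩ := exists_admissible_eq_iff hκ hν hU
  have hle := (dualCost_eq_integral_cdfPlan hκ hU hadm heq).le.trans
    (h.2 _ (cdfPlan_mem_Plans hκ hU))
  have heq' : ∀ᵐ p ∂θ, ∀ u ∈ Icc (0 : ℝ) 1, ∀ y,
      φ p.1 u + ψ p.1 y = u * y ↔ u = cdf (κ p.1) y := by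
    have h1 := ae_of_ae_map measurable_fst.aemeasurable heq
    rw [← h.1.1] at h1
    exact ae_of_ae_map measurable_fst_snd.aemeasurable h1
  filter_upwards [hadm.ae_eq_of_dualCost_le hν h.1 hle, heq', ae_mem_Icc_of_mem_Plans h.1]
    with p hp hiff hu using (hiff _ hu _).1 hp

theorem IsPrimalSolution.eq_cdfPlan (hκ : ν.fst ⊗ₘ κ = ν) (hν : ∀ᵐ p ∂ν, |p.2| ≤ R)
    (hU : ∀ᵐ x ∂ν.fst, (κ x).map (cdf (κ x)) = unif) {θ : Measure (E × ℝ × ℝ)}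
    (h : IsPrimalSolution ν θ) : θ = cdfPlan κ ν := by
  rw [cdfPlan, ← h.1.1, Measure.map_map (measurable_graph_cdf κ) measurable_fst_snd]
  conv_lhs => rw [← Measure.map_id (μ := θ)]
  refine Measure.map_congr ?_
  filter_upwards [h.ae_eq_cdf hκ hν hU] with p hp
  simp [← hp]

end Kernel

end CondQuantile

/-! ### The main theorem -/

open CondQuantile in
theorem mainTheorem7 {Ω : Type*} [MeasurableSpace Ω] (P : Measure Ω) [IsProbabilityMeasure P]
    (N : ℕ) (X : Ω → EuclideanSpace ℝ (Fin N)) (Y : Ω → ℝ) (hX : Measurable X) (hY : Measurable Y)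
    (ν : Measure (EuclideanSpace ℝ (Fin N) × ℝ)) (hν : ν = P.map (fun ω => (X ω, Y ω)))
    (hcpt : ∃ K : Set (EuclideanSpace ℝ (Fin N) × ℝ), IsCompact K ∧ ν Kᶜ = 0)
    (hQ : ∀ᵐ x ∂P.map X, ContinuousOn (CondQuantile.condQ P X Y x) (Ioo 0 1) ∧
      StrictMonoOn (CondQuantile.condQ P X Y x) (Ioo 0 1)) :
    (∀ φ ψ : EuclideanSpace ℝ (Fin N) → ℝ → ℝ, CondQuantile.IsDualSolution ν φ ψ →
      ∀ᵐ x ∂P.map X,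
        (∀ t ∈ Ioo (0 : ℝ) 1, HasDerivAt (φ x) (CondQuantile.condQ P X Y x t) t) ∧
        (∀ y : ℝ, HasDerivAt (ψ x) (CondQuantile.condF P X Y x y) y)) ∧
    (∀ θ : Measure (EuclideanSpace ℝ (Fin N) × ℝ × ℝ), CondQuantile.IsPrimalSolution ν θ →
      ∃ U : Ω → ℝ, Measurable U ∧
        P.map (fun ω => (X ω, Y ω, U ω)) = θ ∧
        (∀ V : Ω → ℝ, AEMeasurable V P → P.map (fun ω => (X ω, Y ω, V ω)) = θ → V =ᵐ[P] U) ∧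
        P.map U = CondQuantile.unif ∧
        IndepFun U X P ∧
        (∀ᵐ ω ∂P, U ω = CondQuantile.condF P X Y (X ω) (Y ω)) ∧
        ∀ φ ψ : EuclideanSpace ℝ (Fin N) → ℝ → ℝ, CondQuantile.IsDualSolution ν φ ψ →
          (∀ᵐ ω ∂P, U ω ∈ Ioo (0 : ℝ) 1 ∧ HasDerivAt (φ (X ω)) (Y ω) (U ω)) ∧
          (∀ V : Ω → ℝ, (∀ᵐ ω ∂P, V ω ∈ Ioo (0 : ℝ) 1 ∧ HasDerivAt (φ (X ω)) (Y ω) (V ω)) →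
            V =ᵐ[P] U)) := by
  set κ := condDistrib Y X P
  have hXY : Measurable fun ω => (X ω, Y ω) := hX.prodMk hY
  have : IsProbabilityMeasure ν := hν ▸ Measure.isProbabilityMeasure_map hXY.aemeasurable
  have hfst : ν.fst = P.map X := by rw [hν]; exact Measure.fst_map_prodMk hY
  have hκ : ν.fst ⊗ₘ κ = ν := by
    rw [hfst, hν]; exact compProd_map_condDistrib hY.aemeasurable
  obtain ⟨R, hR⟩ : ∃ R : ℝ, ∀ᵐ p ∂ν, |p.2| ≤ R := by
    obtain ⟨K, hK, hK0⟩ := hcpt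
    obtain ⟨R, hR⟩ := (hK.image continuous_snd).isBounded.exists_norm_le
    refine ⟨R, ?_⟩
    filter_upwards [measure_eq_zero_iff_ae_notMem.1 hK0] with p hp
    exact hR _ ⟨p, not_notMem.1 hp, rfl⟩
  have hQ' : ∀ᵐ x ∂ν.fst, ContinuousOn (quantile (κ x)) (Ioo 0 1) ∧
      StrictMonoOn (quantile (κ x)) (Ioo 0 1) := hfst ▸ hQ
  have hU : ∀ᵐ x ∂ν.fst, (κ x).map (cdf (κ x)) = unif := by
    filter_upwards [hQ'] with x hx using map_cdf_eq_unif hx.2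
  have part1 : ∀ φ ψ : EuclideanSpace ℝ (Fin N) → ℝ → ℝ, IsDualSolution ν φ ψ →
      ∀ᵐ x ∂P.map X, (∀ t ∈ Ioo (0 : ℝ) 1, HasDerivAt (φ x) (condQ P X Y x t) t) ∧
        (∀ y : ℝ, HasDerivAt (ψ x) (condF P X Y x y) y) := by
    intro φ ψ h
    rw [← hfst]
    filter_upwards [hQ', h.1.ae_eq hκ hR hU, h.2] with x hx hae hconj
    exact ⟨fun t ht => hconj.hasDerivAt_left hx.1 hx.2 hae ht,
      fun y => hconj.hasDerivAt_right hx.1 hx.2 hae y⟩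
  refine ⟨part1, fun θ hθ => ?_⟩
  have hgraph := measurable_graph_cdf κ
  have hUm : Measurable fun ω => cdf (κ (X ω)) (Y ω) := (measurable_cdf_kernel κ).comp hXY
  have hθmap : P.map (fun ω => (X ω, Y ω, cdf (κ (X ω)) (Y ω))) = θ := by
    rw [hθ.eq_cdfPlan hκ hR hU, cdfPlan, hν, Measure.map_map hgraph hXY]
    rfl
  have hprod : P.map (fun ω => (X ω, cdf (κ (X ω)) (Y ω))) = (P.map X).prod unif := by
    rw [← hfst, ← hθ.1.2, ← hθmap,
      Measure.map_map measurable_fst_third (hX.prodMk (hY.prodMk hUm))]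
    rfl
  have hUlaw : P.map (fun ω => cdf (κ (X ω)) (Y ω)) = unif := by
    have h := congrArg Measure.snd hprod
    have : IsProbabilityMeasure (P.map X) := Measure.isProbabilityMeasure_map hX.aemeasurable
    rwa [Measure.snd_map_prodMk hX, Measure.snd_prod] at h
  refine ⟨fun ω => cdf (κ (X ω)) (Y ω), hUm, hθmap, fun V hV hVθ => ?_, hUlaw, ?_,
    Filter.Eventually.of_forall fun ω => rfl, fun φ ψ h => ?_⟩
  · have hae := hθ.ae_eq_cdf hκ hR hU
    rw [← hVθ] at hae
    exact ae_of_ae_map (hX.aemeasurable.prodMk (hY.aemeasurable.prodMk hV)) hae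
  · refine IndepFun.symm ?_
    rw [indepFun_iff_map_prod_eq_prod_map_map hX.aemeasurable hUm.aemeasurable, hUlaw, hprod]
  · have hQP := ae_of_ae_map hX.aemeasurable hQ
    have hder := ae_of_ae_map hX.aemeasurable (part1 φ ψ h)
    have hUI : ∀ᵐ ω ∂P, cdf (κ (X ω)) (Y ω) ∈ Ioo (0 : ℝ) 1 :=
      ae_of_ae_map hUm.aemeasurable (hUlaw ▸ ae_unif_mem_Ioo)
    refine ⟨?_, fun V hV => ?_⟩
    · filter_upwards [hQP, hder, hUI] with ω h1 h2 h3
      refine ⟨h3, ?_⟩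
      have h4 := h2.1 _ h3
      have h5 : condQ P X Y (X ω) (cdf (κ (X ω)) (Y ω)) = Y ω := quantile_cdf h1.1 h3
      rwa [h5] at h4
    · filter_upwards [hQP, hder, hV] with ω h1 h2 h3
      -- Uniqueness of the derivative identifies `Y` with `Q(X, V)`; applying `F` then recovers `V`.
      have h4 : Y ω = quantile (κ (X ω)) (V ω) := h3.2.unique (h2.1 _ h3.1)
      rw [h4, cdf_quantile h1.2 h3.1]
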